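/- Let $\Omega\subset\mathbb R^d$ be a bounded open set (for instance a bounded Lipschitz domain) and let $\gamma$ be a finite positive Borel measure on $\Omega$. For $u\in L^1(\Omega)$ whose distributional gradient $Du$ is a finite $\mathbb R^d$-valued measure on $\Omega$ (that is, $u\in BV(\Omega)$), set $$\mathrm{TV}_{\mathrm{pwL}}^{\gamma}(u):=\inf\bigl\{\,|Du-g|(\Omega)\;:\; g \text{ an } \mathbb R^d\text{-valued finite measure on }\Omega,\ |g|\le\gamma \,\bigr\},$$ where $|\cdot|$ denotes the variation measure with respect to the Euclidean norm, and set $\mathrm{TV}_{\mathrm{pwL}}^{\gamma}(u):=+\infty$ for all other $u\in L^1(\Omega)$. Theorem (maximum principle). Let $f\in L^2(\Omega)$ and let $u\in BV(\Omega)$ be a minimiser over $BV(\Omega)$ of $$v\mapsto \tfrac12\|v-f\|_{L^2(\Omega)}^2+\mathrm{TV}_{\mathrm{pwL}}^{\gamma}(v)\in[0,+\infty].$$ Then $$\operatorname*{ess\,sup}_{\Omega}u\le\operatorname*{ess\,sup}_{\Omega}f\qquad\text{and}\qquad \operatorname*{ess\,inf}_{\Omega}u\ge\operatorname*{ess\,inf}_{\Omega}f,$$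 where the essential bounds of $f$ and $u$ are taken in $[-\infty,+\infty]$. -/

import Mathlib

open MeasureTheory TopologicalSpace
open scoped ENNReal Distributions Gradient

namespace PwL

/-- Lebesgue measure on the open set `Ω`, as a measure on the subtype. -/
noncomputable def leb {d : ℕ} (Ω : Opens (EuclideanSpace ℝ (Fin d))) : Measure Ω :=
  (volume : Measure (EuclideanSpace ℝ (Fin d))).comap Subtype.val

/-- The finite vector measure `μ` on the open set `Ω ⊆ ℝᵈ` is the weak (distributional) gradient
of `u`: `∫_Ω u ∇φ dx = - ∫_Ω φ dμ` in `ℝᵈ` for every scalar test function `φ ∈ C_c^∞(Ω)`. -/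
def HasWeakGradient {d : ℕ} {Ω : Opens (EuclideanSpace ℝ (Fin d))} (u : Ω → ℝ)
    (μ : VectorMeasure Ω (EuclideanSpace ℝ (Fin d))) : Prop :=
  ∀ φ : 𝓓(Ω, ℝ), ∫ x : Ω, u x • ∇ φ (x : EuclideanSpace ℝ (Fin d)) ∂(leb Ω) =
    -VectorMeasure.integral μ (fun x : Ω => φ (x : EuclideanSpace ℝ (Fin d)))
      (ContinuousLinearMap.lsmul ℝ ℝ)

/-- Functions of bounded variation on `Ω`: integrable functions whose weak gradient is a
finite vector measure. -/
def BV {d : ℕ} (Ω : Opens (EuclideanSpace ℝ (Fin d))) : Set (Ω → ℝ) :=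
  {u | Integrable u (leb Ω) ∧ ∃ μ : VectorMeasure Ω (EuclideanSpace ℝ (Fin d)), HasWeakGradient u μ}

/-- The Radon norm `‖μ‖ = |μ|(Ω)` of a vector measure. -/
noncomputable def radonNorm {d : ℕ} {Ω : Opens (EuclideanSpace ℝ (Fin d))}
    (μ : VectorMeasure Ω (EuclideanSpace ℝ (Fin d))) : ℝ≥0∞ :=
  μ.variation Set.univ

/-- The piecewise Lipschitz total variation: the infimum of `‖Du - g‖` over all vector measures
`g` with `|g| ≤ γ`. It is `∞` if `Du` is not a finite measure (the outer infimum is then empty;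
otherwise it runs over the unique weak gradient `Du`). -/
noncomputable def TVpwL {d : ℕ} {Ω : Opens (EuclideanSpace ℝ (Fin d))} (γ : Measure Ω)
    (u : Ω → ℝ) : ℝ≥0∞ :=
  ⨅ (Du : VectorMeasure Ω (EuclideanSpace ℝ (Fin d))) (_ : HasWeakGradient u Du)
    (g : VectorMeasure Ω (EuclideanSpace ℝ (Fin d))) (_ : g.variation ≤ γ), radonNorm (Du - g)

/-- The denoising functional `½ ‖u - f‖²_{L²(Ω)} + TV_pwL^γ(u)`, with values in `[0, ∞]`. -/
noncomputable def energy {d : ℕ} {Ω : Opens (EuclideanSpace ℝ (Fin d))} (γ : Measure Ω)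
    (f u : Ω → ℝ) : ℝ≥0∞ :=
  (1 / 2) * eLpNorm (u - f) 2 (leb Ω) ^ 2 + TVpwL γ u

end PwL

open Filter Topology

namespace PwL

/-! ### Vector measures as densities -/

section Density

variable {X : Type*} [MeasurableSpace X] {ι : Type*} [Fintype ι]

/-! Let `c` be a real upper bound for `f`. Subtract from `u` a smooth, bounded substitute `bend c (u
x)` for the excess of `u` over `c`. Where `u > c` this moves `u` strictly closer to `f`, and
elsewhere it changes nothing, so the fidelity term drops strictly unless `u ≤ c` a.e. It remains to
see that `TVpwL` does not grow.

The chain rule `exists_chain_rule` gives `D(b(u)) = ϑ Du` with a scalar `ϑ` in `[0, 1]`, so the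
competitor has gradient `(1 - ϑ) Du`. For an admissible `g`, the measure `(1 - ϑ) g` is again
admissible, and the difference of the two is `(1 - ϑ)(Du - g)`, of no larger variation: this is
`TVpwL_sub_bend_le`. For the products to make sense, `Du` and `g` are written as densities against
one finite measure. No structure theory of BV is needed, only the bounds on `ϑ`, which is obtained
as a weak limit from mollifications.

Minimality then gives `ae_le_of_isMinOn_energy`, and the symmetry `u ↦ -u`, `f ↦ -f` gives the lower
bound. -/

theorem exists_withDensityᵥ_eq (μ : VectorMeasure X (EuclideanSpace ℝ ι)) (m : Measure X)
    [IsFiniteMeasure m] (h : μ.variation ≤ m) :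
    ∃ σ : X → EuclideanSpace ℝ ι, Measurable σ ∧ Integrable σ m ∧ μ = m.withDensityᵥ σ ∧
      ∀ x, ‖σ x‖ ≤ 1 := by
  classical
  let s : ι → SignedMeasure X := fun i =>
    μ.mapRange (EuclideanSpace.proj (𝕜 := ℝ) i : EuclideanSpace ℝ ι →L[ℝ] ℝ).toLinearMap.toAddMonoidHom
      (EuclideanSpace.proj (𝕜 := ℝ) i : EuclideanSpace ℝ ι →L[ℝ] ℝ).continuous
  have hs : ∀ i A, s i A = μ A i := fun i A => rfl
  have hac : ∀ i, s i ≪ᵥ m.toENNRealVectorMeasure := by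
    intro i
    refine VectorMeasure.AbsolutelyContinuous.mk fun A hA h0 => ?_
    rw [Measure.toENNRealVectorMeasure_apply_measurable hA] at h0
    have h1 : μ.variation A = 0 := le_antisymm ((h A).trans h0.le) bot_le
    have h2 : μ A = 0 := by
      have := (μ.enorm_measure_le_variation A).trans h1.le
      simpa using this
    simp [hs, h2]
  have hd : ∀ i, m.withDensityᵥ ((s i).rnDeriv m) = s i := fun i =>
    (SignedMeasure.absolutelyContinuous_iff_withDensityᵥ_rnDeriv_eq (s i) m).1 (hac i)
  let σ : X → EuclideanSpace ℝ ι := fun x => WithLp.toLp 2 fun i => (s i).rnDeriv m x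
  have hσm : Measurable σ :=
    (PiLp.continuous_toLp 2 _).measurable.comp
      (measurable_pi_lambda _ fun i => SignedMeasure.measurable_rnDeriv (s i) m)
  have hσi : Integrable σ m := by
    have : σ = fun x => ∑ i, (s i).rnDeriv m x • EuclideanSpace.single i (1 : ℝ) := by
      ext x j
      simp [σ, Finset.sum_apply, Pi.single_apply]
    rw [this]
    exact integrable_finsetSum _ fun i _ => (SignedMeasure.integrable_rnDeriv (s i) m).smul_const _
  have hμ : μ = m.withDensityᵥ σ := by
    ext A hA i
    rw [withDensityᵥ_apply hσi hA, ← hs, ← hd,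
      withDensityᵥ_apply (SignedMeasure.integrable_rnDeriv (s i) m) hA]
    exact ((EuclideanSpace.proj (𝕜 := ℝ) i : EuclideanSpace ℝ ι →L[ℝ] ℝ).integral_comp_comm
      hσi.integrableOn)
  have h' := h
  rw [hμ, Measure.variation_withDensityᵥ hσi] at h'
  -- The variation of `m.withDensityᵥ σ` has density `‖σ‖` against `m`, so domination by `m` bounds
  -- this density by 1.
  have key : (fun x => ‖σ x‖ₑ) ≤ᵐ[m] fun _ => 1 := by
    refine ae_le_of_forall_setLIntegral_le_of_sigmaFinite hσm.enorm fun A hA _ => ?_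
    rw [← withDensity_apply _ hA]
    simpa using h' A
  -- Zeroing `σ` off this conull set makes the bound hold everywhere.
  let A : Set X := {x | ‖σ x‖ ≤ 1}
  have hA : MeasurableSet A := measurableSet_le hσm.norm measurable_const
  have hae : σ =ᵐ[m] A.indicator σ := by
    filter_upwards [key] with x hx
    rw [← ofReal_norm, ← ENNReal.ofReal_one] at hx
    exact (Set.indicator_of_mem (s := A) ((ENNReal.ofReal_le_ofReal_iff zero_le_one).1 hx) σ).symm
  refine ⟨A.indicator σ, hσm.indicator hA, hσi.indicator hA,
    hμ.trans (WithDensityᵥEq.congr_ae hae), fun x => ?_⟩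
  by_cases hx : x ∈ A
  · rw [Set.indicator_of_mem hx]; exact hx
  · simp [Set.indicator_of_notMem hx]

theorem integral_withDensityᵥ_lsmul {E : Type*} [NormedAddCommGroup E] [NormedSpace ℝ E]
    [CompleteSpace E] {m : Measure X} [IsFiniteMeasure m] {σ : X → E}
    (hσ : Integrable σ m) {φ : X → ℝ} (hφ : Measurable φ) {C : ℝ} (hC : ∀ x, ‖φ x‖ ≤ C) :
    VectorMeasure.integral (m.withDensityᵥ σ) φ (ContinuousLinearMap.lsmul ℝ ℝ) =
      ∫ x, φ x • σ x ∂m := by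
  have hvar := Measure.variation_withDensityᵥ hσ
  have : IsFiniteMeasure (m.withDensityᵥ σ).variation := by
    rw [hvar]; exact ⟨by simpa using! hσ.2⟩
  have hb : ∀ {f : X → ℝ} {K : ℝ}, Measurable f → (∀ x, ‖f x‖ ≤ K) → Integrable (fun x => f x • σ x) m :=
    fun hf hK => hσ.bdd_smul _ hf.aestronglyMeasurable (ae_of_all _ hK)
  have simple : ∀ f : SimpleFunc X ℝ,
      VectorMeasure.integral (m.withDensityᵥ σ) f (ContinuousLinearMap.lsmul ℝ ℝ) =
      ∫ x, f x • σ x ∂m := by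
    intro f
    induction f using SimpleFunc.induction with
    | @const c s hs =>
      have h1 : ⇑(SimpleFunc.piecewise s hs (SimpleFunc.const X c) (SimpleFunc.const X 0)) =
          s.indicator fun _ => c := by
        ext x; simp [Set.indicator, Set.piecewise]
      rw [h1]
      rw [VectorMeasure.integral_indicator_const _ hs, withDensityᵥ_apply hσ hs]
      rw [← integral_indicator hs]
      simp only [ContinuousLinearMap.lsmul_apply]
      rw [← integral_smul]
      congr with x
      by_cases hx : x ∈ s <;> simp [hx]
    | add hd hf hg =>
      rename_i f g
      have hfi : ∀ f : SimpleFunc X ℝ, (m.withDensityᵥ σ).Integrable f := fun f => by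
        obtain ⟨K, hK⟩ := f.exists_forall_norm_le
        exact Integrable.of_bound f.measurable.aestronglyMeasurable K (ae_of_all _ hK)
      rw [SimpleFunc.coe_add, VectorMeasure.integral_add (hfi f) (hfi g), hf, hg]
      obtain ⟨K, hK⟩ := f.exists_forall_norm_le
      obtain ⟨K', hK'⟩ := g.exists_forall_norm_le
      rw [← integral_add (hb f.measurable hK) (hb g.measurable hK')]
      simp [add_smul]
  let F : ℕ → SimpleFunc X ℝ := SimpleFunc.approxOn φ hφ Set.univ 0 (Set.mem_univ _)
  have hF : ∀ x, Tendsto (fun n => F n x) atTop (𝓝 (φ x)) := fun x =>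
    SimpleFunc.tendsto_approxOn hφ (Set.mem_univ _) (by simp)
  have hFb : ∀ n x, ‖F n x‖ ≤ C + C := fun n x =>
    (SimpleFunc.norm_approxOn_zero_le hφ (Set.mem_univ _) x n).trans (add_le_add (hC x) (hC x))
  have l1 : Tendsto (fun n => VectorMeasure.integral (m.withDensityᵥ σ) (F n)
      (ContinuousLinearMap.lsmul ℝ ℝ)) atTop
      (𝓝 (VectorMeasure.integral (m.withDensityᵥ σ) φ (ContinuousLinearMap.lsmul ℝ ℝ))) :=
    VectorMeasure.tendsto_integral_of_dominated_convergence (fun _ => C + C)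
      (fun n => (F n).measurable.aestronglyMeasurable) (integrable_const _)
      (fun n => ae_of_all _ (hFb n)) (ae_of_all _ hF)
  have l2 : Tendsto (fun n => ∫ x, F n x • σ x ∂m) atTop (𝓝 (∫ x, φ x • σ x ∂m)) := by
    refine tendsto_integral_of_dominated_convergence (fun x => (C + C) * ‖σ x‖)
      (fun n => (hb (F n).measurable (hFb n)).aestronglyMeasurable) (hσ.norm.const_mul _)
      (fun n => ae_of_all _ fun x => ?_) (ae_of_all _ fun x => (hF x).smul_const _)
    rw [norm_smul]
    exact mul_le_mul_of_nonneg_right (hFb n x) (norm_nonneg _)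
  simp only [simple] at l1
  exact tendsto_nhds_unique l1 l2

end Density

/-- Banach–Alaoglu in the dual of `L²(m)`. Using an ultrafilter instead of a subsequence avoids any
separability question, and yields one limit for all `ψ`. -/
theorem exists_weak_limit_of_mem_Icc {X : Type*} [MeasurableSpace X] {m : Measure X}
    [IsFiniteMeasure m] {θ : ℕ → X → ℝ} (hθ : ∀ n, Measurable (θ n))
    (hθ01 : ∀ n x, θ n x ∈ Set.Icc (0 : ℝ) 1) :
    ∃ ϑ : X → ℝ, Measurable ϑ ∧ (∀ x, ϑ x ∈ Set.Icc (0 : ℝ) 1) ∧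
      ∀ ψ : X → ℝ, MemLp ψ 2 m →
        Tendsto (fun n => ∫ x, ψ x * θ n x ∂m) (hyperfilter ℕ : Filter ℕ)
          (𝓝 (∫ x, ψ x * ϑ x ∂m)) := by
  have hb : ∀ n x, ‖θ n x‖ ≤ 1 := fun n x => by
    rw [Real.norm_of_nonneg (hθ01 n x).1]; exact (hθ01 n x).2
  have hmem : ∀ n, MemLp (θ n) 2 m := fun n =>
    MemLp.of_bound (hθ n).aestronglyMeasurable 1 (ae_of_all _ (hb n))
  let t : ℕ → Lp ℝ 2 m := fun n => (hmem n).toLp (θ n)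
  obtain ⟨R, hR⟩ : ∃ R : ℝ, ∀ n, ‖t n‖ ≤ R := by
    refine ⟨_, fun n => Lp.norm_le_of_ae_bound zero_le_one ?_⟩
    filter_upwards [(hmem n).coeFn_toLp] with x hx
    rw [hx]; exact hb n x
  let D : ℕ → WeakDual ℝ (Lp ℝ 2 m) := fun n =>
    StrongDual.toWeakDual (InnerProductSpace.toDual ℝ (Lp ℝ 2 m) (t n))
  have hD : ∀ n, D n ∈ WeakDual.toStrongDual ⁻¹' Metric.closedBall (0 : StrongDual ℝ (Lp ℝ 2 m)) R := by
    intro n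
    simp only [Set.mem_preimage, mem_closedBall_zero_iff, D]
    exact ((InnerProductSpace.toDual ℝ (Lp ℝ 2 m)).norm_map (t n)).le.trans (hR n)
  obtain ⟨Dl, -, hDl⟩ := (WeakDual.isCompact_closedBall (𝕜 := ℝ) (0 : StrongDual ℝ (Lp ℝ 2 m)) R).ultrafilter_le_nhds
    ((hyperfilter ℕ).map D) (by
      rw [Ultrafilter.coe_map]
      exact tendsto_principal.2 (Eventually.of_forall hD))
  have hDl' : Tendsto D (hyperfilter ℕ : Filter ℕ) (𝓝 Dl) := hDl
  let ϑ₀ : Lp ℝ 2 m := (InnerProductSpace.toDual ℝ (Lp ℝ 2 m)).symm (WeakDual.toStrongDual Dl)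
  have lim₀ : ∀ ψ : X → ℝ, MemLp ψ 2 m →
        Tendsto (fun n => ∫ x, ψ x * θ n x ∂m) (hyperfilter ℕ : Filter ℕ)
          (𝓝 (∫ x, ψ x * ϑ₀ x ∂m)) := by
    intro ψ hψ
    have h1 : Tendsto (fun n => D n (hψ.toLp ψ)) (hyperfilter ℕ : Filter ℕ)
        (𝓝 (Dl (hψ.toLp ψ))) := ((WeakDual.eval_continuous (hψ.toLp ψ)).tendsto Dl).comp hDl'
    have h2 : Dl (hψ.toLp ψ) = ∫ x, ψ x * ϑ₀ x ∂m := by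
      have : Dl (hψ.toLp ψ) = inner ℝ ϑ₀ (hψ.toLp ψ) := by
        simp only [ϑ₀, InnerProductSpace.toDual_symm_apply]; rfl
      rw [this, L2.inner_def]
      refine integral_congr_ae ?_
      filter_upwards [hψ.coeFn_toLp] with x hx
      simp [hx]
    have h3 : ∀ n, D n (hψ.toLp ψ) = ∫ x, ψ x * θ n x ∂m := by
      intro n
      have : D n (hψ.toLp ψ) = inner ℝ (t n) (hψ.toLp ψ) := rfl
      rw [this, L2.inner_def]
      refine integral_congr_ae ?_
      filter_upwards [hψ.coeFn_toLp, (hmem n).coeFn_toLp] with x hx hx'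
      simp [hx, t, hx']
    rw [h2] at h1
    simpa only [h3] using h1
  have hint : Integrable ϑ₀ m := (Lp.memLp ϑ₀).integrable (by norm_num)
  -- Testing against indicators carries the bounds 0 and 1 over to the limit.
  have hset : ∀ s, MeasurableSet s → Tendsto (fun n => ∫ x in s, θ n x ∂m)
      (hyperfilter ℕ : Filter ℕ) (𝓝 (∫ x in s, ϑ₀ x ∂m)) := by
    intro s hs
    have := lim₀ (s.indicator fun _ => 1) ((memLp_const (1 : ℝ)).indicator hs)
    have e : ∀ g : X → ℝ, ∫ x, s.indicator (fun _ => (1 : ℝ)) x * g x ∂m = ∫ x in s, g x ∂m := by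
      intro g
      rw [← integral_indicator hs]
      congr with x
      by_cases hx : x ∈ s <;> simp [hx]
    simpa only [e] using this
  have h0 : 0 ≤ᵐ[m] ϑ₀ := ae_nonneg_of_forall_setIntegral_nonneg hint fun s hs _ =>
    ge_of_tendsto (hset s hs) (Eventually.of_forall fun n => integral_nonneg fun x => (hθ01 n x).1)
  have h1 : ϑ₀ ≤ᵐ[m] fun _ => 1 := by
    refine ae_le_of_forall_setIntegral_le hint (integrable_const _) fun s hs _ => ?_
    refine le_of_tendsto (hset s hs) (Eventually.of_forall fun n => ?_)
    exact integral_mono ((hmem n).integrable (by norm_num)).integrableOn (integrable_const _)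
      fun x => (hθ01 n x).2
  -- Clamping alters `ϑ₀` only on a null set and makes the bounds hold everywhere.
  refine ⟨fun x => max 0 (min 1 (ϑ₀ x)), ?_, fun x => ⟨le_max_left _ _, ?_⟩, fun ψ hψ => ?_⟩
  · exact measurable_const.max (measurable_const.min (Lp.stronglyMeasurable ϑ₀).measurable)
  · exact max_le zero_le_one (min_le_left _ _)
  · convert lim₀ ψ hψ using 2
    refine integral_congr_ae ?_
    filter_upwards [h0, h1] with x hx hx'
    rw [min_eq_right hx', max_eq_right (by simpa using hx)]

/-! ### Mollification and the chain rule -/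

section Mollification

open scoped Convolution

variable {E : Type*} [NormedAddCommGroup E] [InnerProductSpace ℝ E] [FiniteDimensional ℝ E]
  [MeasurableSpace E] [BorelSpace E]

/-- The mollification of `U` by the normalised bump function `ρ`. -/
noncomputable def mollify (ρ : ContDiffBump (0 : E)) (U : E → ℝ) : E → ℝ :=
  (ρ.normed volume) ⋆[ContinuousLinearMap.lsmul ℝ ℝ, volume] U

theorem contDiff_mollify (ρ : ContDiffBump (0 : E)) {U : E → ℝ} (hU : Integrable U) :
    ContDiff ℝ 1 (mollify ρ U) :=
  ρ.hasCompactSupport_normed.contDiff_convolution_left _ ρ.contDiff_normed hU.locallyIntegrable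

theorem fderiv_mollify_apply (ρ : ContDiffBump (0 : E)) {U : E → ℝ} (hU : Integrable U) (x v : E) :
    fderiv ℝ (mollify ρ U) x v =
      ∫ y, U y * fderiv ℝ (ρ.normed volume) (x - y) v := by
  have h1 : HasFDerivAt (mollify ρ U) _ x :=
    ρ.hasCompactSupport_normed.hasFDerivAt_convolution_left (ContinuousLinearMap.lsmul ℝ ℝ)
    (μ := volume) ρ.contDiff_normed hU.locallyIntegrable x
  have hex : ConvolutionExistsAt (fderiv ℝ (ρ.normed volume)) U x
      ((ContinuousLinearMap.lsmul ℝ ℝ : ℝ →L[ℝ] ℝ →L[ℝ] ℝ).precompL E) volume :=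
    (ρ.hasCompactSupport_normed.fderiv ℝ).convolutionExists_left _
      ((ρ.contDiff_normed (n := 1)).continuous_fderiv one_ne_zero) hU.locallyIntegrable x
  rw [h1.fderiv, convolution_def, ContinuousLinearMap.integral_apply hex,
    ← integral_sub_left_eq_self _ volume x]
  refine integral_congr_ae (ae_of_all _ fun y => ?_)
  simp [ContinuousLinearMap.precompL_apply, mul_comm]

/-- The reflected bump `y ↦ ρ (x - y)` is itself a test function as soon as its closed support ball
lies in `Ω`. -/
theorem fderiv_mollify_eq_integral {Ω : Opens E} {U : E → ℝ} (hU : Integrable U) {m : Measure E}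
    {T : E → ℝ} {v : E}
    (h : ∀ φ : 𝓓(Ω, ℝ), ∫ x, U x * fderiv ℝ φ x v = -∫ y, φ y * T y ∂m)
    (ρ : ContDiffBump (0 : E)) {x : E} (hx : Metric.closedBall x ρ.rOut ⊆ Ω) :
    fderiv ℝ (mollify ρ U) x v = ∫ y, ρ.normed volume (x - y) * T y ∂m := by
  have hsupp : tsupport (fun y => ρ.normed volume (x - y)) ⊆ Metric.closedBall x ρ.rOut := by
    refine closure_minimal (fun y hy => ?_) Metric.isClosed_closedBall
    have : x - y ∈ tsupport (ρ.normed volume) := subset_closure hy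
    rw [ρ.tsupport_normed_eq] at this
    simpa [dist_eq_norm, norm_sub_rev] using this
  let φ : 𝓓(Ω, ℝ) :=
    { toFun := fun y => ρ.normed volume (x - y)
      contDiff' := ρ.contDiff_normed.comp (contDiff_const.sub contDiff_id)
      hasCompactSupport' := (isCompact_closedBall x ρ.rOut).of_isClosed_subset
        (isClosed_tsupport _) hsupp
      tsupport_subset' := hsupp.trans hx }
  have hφ := h φ
  have hd : ∀ y, fderiv ℝ φ y v = -fderiv ℝ (ρ.normed volume) (x - y) v := by
    intro y
    have h1 : HasFDerivAt φ ((fderiv ℝ (ρ.normed volume) (x - y)).comp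
        (-ContinuousLinearMap.id ℝ E)) y :=
      ((ρ.contDiff_normed (n := 1)).differentiable one_ne_zero (x - y)).hasFDerivAt.comp y
        ((hasFDerivAt_id y).const_sub x)
    simp [h1.fderiv]
  simp only [hd, mul_neg, integral_neg, neg_inj] at hφ
  rw [fderiv_mollify_apply ρ hU]
  exact hφ

theorem integral_normed_sub (ρ : ContDiffBump (0 : E)) (y : E) :
    ∫ x, ρ.normed volume (x - y) = 1 := by
  rw [integral_sub_right_eq_self (ρ.normed volume) y, ρ.integral_normed]

theorem integrable_normed_sub (ρ : ContDiffBump (0 : E)) (y : E) :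
    Integrable fun x => ρ.normed volume (x - y) :=
  ρ.integrable_normed.comp_sub_right y

/-- The average of `w` against the bump function centred at `y`. -/
noncomputable def average (ρ : ContDiffBump (0 : E)) (w : E → ℝ) (y : E) : ℝ :=
  ∫ x, w x * ρ.normed volume (x - y)

theorem integrable_mul_normed_sub (ρ : ContDiffBump (0 : E)) {w : E → ℝ} (hw : Continuous w) {C : ℝ}
    (hC : ∀ x, ‖w x‖ ≤ C) (y : E) : Integrable fun x => w x * ρ.normed volume (x - y) :=
  (integrable_normed_sub ρ y).bdd_mul hw.aestronglyMeasurable (ae_of_all _ hC)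

theorem average_mem_Icc (ρ : ContDiffBump (0 : E)) {w : E → ℝ} (hw : Continuous w)
    (h01 : ∀ x, w x ∈ Set.Icc (0 : ℝ) 1) (y : E) : average ρ w y ∈ Set.Icc (0 : ℝ) 1 := by
  refine ⟨integral_nonneg fun x => mul_nonneg (h01 x).1 (ρ.nonneg_normed _), ?_⟩
  rw [← integral_normed_sub ρ y]
  refine integral_mono (integrable_mul_normed_sub ρ hw (C := 1) (fun x => ?_) y)
    (integrable_normed_sub ρ y) fun x => ?_
  · rw [Real.norm_of_nonneg (h01 x).1]; exact (h01 x).2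
  · exact mul_le_of_le_one_left (ρ.nonneg_normed _) (h01 x).2

theorem measurable_average (ρ : ContDiffBump (0 : E)) {w : E → ℝ} (hw : Continuous w) :
    Measurable (average ρ w) := by
  refine StronglyMeasurable.measurable ?_
  refine StronglyMeasurable.integral_prod_right (f := fun y x => w x * ρ.normed volume (x - y)) ?_
  refine Continuous.stronglyMeasurable ?_
  have := ρ.continuous_normed (μ := volume)
  simp only [Function.uncurry_def]
  fun_prop

theorem abs_average_mul_sub_le (ρ : ContDiffBump (0 : E)) {w φ : E → ℝ} (hw : Continuous w)
    (h01 : ∀ x, w x ∈ Set.Icc (0 : ℝ) 1) (hφ : Continuous φ) {C : ℝ} (hC : ∀ x, ‖φ x‖ ≤ C)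
    {ε : ℝ} {y : E} (hε : ∀ x, dist x y < ρ.rOut → |φ x - φ y| ≤ ε) :
    |average ρ (fun x => φ x * w x) y - φ y * average ρ w y| ≤ ε := by
  have hw1 : ∀ x, ‖w x‖ ≤ 1 := fun x => by
    rw [Real.norm_of_nonneg (h01 x).1]; exact (h01 x).2
  have hC0 : 0 ≤ C := (norm_nonneg _).trans (hC 0)
  have hφw : ∀ x, ‖φ x * w x‖ ≤ C * 1 := fun x => by
    rw [norm_mul]; exact mul_le_mul (hC x) (hw1 x) (norm_nonneg _) hC0
  have i1 : Integrable fun x => φ x * w x * ρ.normed volume (x - y) :=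
    integrable_mul_normed_sub ρ (hφ.mul hw) hφw y
  have i2 := integrable_mul_normed_sub ρ hw hw1 y
  rw [average, average, ← integral_const_mul, ← integral_sub i1 (i2.const_mul _),
    ← Real.norm_eq_abs]
  calc _ ≤ ∫ x, ε * ρ.normed volume (x - y) := by
        refine norm_integral_le_of_norm_le ((integrable_normed_sub ρ y).const_mul ε)
          (ae_of_all _ fun x => ?_)
        by_cases hx : dist x y < ρ.rOut
        · have e : φ x * w x * ρ.normed volume (x - y) - φ y * (w x * ρ.normed volume (x - y)) =
            (φ x - φ y) * w x * ρ.normed volume (x - y) := by ring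
          rw [e, norm_mul, norm_mul, Real.norm_of_nonneg (ρ.nonneg_normed _)]
          refine mul_le_mul_of_nonneg_right ?_ (ρ.nonneg_normed _)
          have := hε x hx
          calc _ ≤ ε * 1 := mul_le_mul this (hw1 x) (norm_nonneg _) ((abs_nonneg _).trans this)
            _ = ε := mul_one _
        · have : ρ.normed volume (x - y) = 0 := by
            rw [← Function.notMem_support, ρ.support_normed_eq]
            simpa [← dist_eq_norm] using hx
          simp [this]
    _ = ε := by rw [integral_const_mul, integral_normed_sub, mul_one]

theorem integral_mul_integral_normed {m : Measure E} [IsFiniteMeasure m] (ρ : ContDiffBump (0 : E))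
    {w T : E → ℝ} (hw : Continuous w) (hwc : HasCompactSupport w) (hT : Measurable T)
    {C : ℝ} (hC : ∀ y, ‖T y‖ ≤ C) :
    ∫ x, w x * ∫ y, ρ.normed volume (x - y) * T y ∂m = ∫ y, T y * average ρ w y ∂m := by
  have hρc := ρ.continuous_normed (μ := volume)
  obtain ⟨M, hM⟩ := hρc.bounded_above_of_compact_support ρ.hasCompactSupport_normed
  have hC0 : 0 ≤ C := (norm_nonneg _).trans (hC 0)
  have hint : Integrable (fun p : E × E => w p.1 * (ρ.normed volume (p.1 - p.2) * T p.2))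
      (volume.prod m) := by
    have h1 : Integrable (fun p : E × E => w p.1 * (1 : ℝ)) (volume.prod m) :=
      (hw.integrable_of_hasCompactSupport hwc).mul_prod (integrable_const _)
    simp only [mul_one] at h1
    refine h1.mul_bdd (c := M * C) ?_ (ae_of_all _ fun p => ?_)
    · have : Measurable fun p : E × E => ρ.normed volume (p.1 - p.2) :=
        (hρc.comp (continuous_fst.sub continuous_snd)).measurable
      exact (this.mul (hT.comp measurable_snd)).aestronglyMeasurable
    · rw [norm_mul]
      exact mul_le_mul (hM _) (hC _) (norm_nonneg _) ((norm_nonneg _).trans (hM 0))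
  simp only [average, ← integral_const_mul]
  rw [integral_integral_swap hint]
  refine integral_congr_ae (ae_of_all _ fun y => integral_congr_ae (ae_of_all _ fun x => ?_))
  ring

/-- Integrate by parts with the classical chain rule for the mollified function, then use Fubini to
move the mollifier from the gradient measure onto `φ * b'`. Only points of `tsupport φ` matter, so
the behaviour of `U` across the boundary of `Ω` is never seen. -/
theorem integral_comp_mollify_mul_fderiv {Ω : Opens E} {U : E → ℝ} (hU : Integrable U)
    {m : Measure E} [IsFiniteMeasure m]
    {T : E → ℝ} {v : E} (hT : Measurable T) {C : ℝ} (hC : ∀ y, ‖T y‖ ≤ C)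
    (h : ∀ φ : 𝓓(Ω, ℝ), ∫ x, U x * fderiv ℝ φ x v = -∫ y, φ y * T y ∂m)
    {b b' : ℝ → ℝ} (hb : ∀ s, HasDerivAt b (b' s) s) (hb' : Continuous b') (φ : 𝓓(Ω, ℝ))
    (ρ : ContDiffBump (0 : E)) (hρ : ∀ x ∈ tsupport φ, Metric.closedBall x ρ.rOut ⊆ Ω) :
    ∫ x, b (mollify ρ U x) * fderiv ℝ φ x v =
      -∫ y, T y * average ρ (fun x => φ x * b' (mollify ρ U x)) y ∂m := by
  have hm := contDiff_mollify ρ hU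
  have hmc : Continuous (mollify ρ U) := hm.continuous
  have hφd : ContDiff ℝ 1 φ := φ.contDiff.of_le (by simp)
  have hbc : Continuous b := continuous_iff_continuousAt.2 fun s => (hb s).continuousAt
  have hd : ∀ x, HasFDerivAt (fun x => b (mollify ρ U x))
      (b' (mollify ρ U x) • fderiv ℝ (mollify ρ U) x) x := fun x =>
    (hb _).comp_hasFDerivAt x (hm.differentiable one_ne_zero x).hasFDerivAt
  have hfd : ∀ x, fderiv ℝ (fun x => b (mollify ρ U x)) x v =
      b' (mollify ρ U x) * fderiv ℝ (mollify ρ U) x v := fun x => by simp [(hd x).fderiv]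
  have hmdc : Continuous fun x => fderiv ℝ (mollify ρ U) x v :=
    (hm.continuous_fderiv one_ne_zero).clm_apply continuous_const
  have hφdc : Continuous fun x => fderiv ℝ φ x v :=
    (hφd.continuous_fderiv one_ne_zero).clm_apply continuous_const
  have hφs : HasCompactSupport fun x => fderiv ℝ φ x v := φ.hasCompactSupport.fderiv_apply ℝ v
  rw [integral_mul_fderiv_eq_neg_fderiv_mul_of_integrable
    (f := fun x => b (mollify ρ U x)) (g := φ) (v := v)]
  · rw [← integral_mul_integral_normed ρ (w := fun x => φ x * b' (mollify ρ U x))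
      (φ.continuous.mul (hb'.comp hmc)) φ.hasCompactSupport.mul_right hT hC]
    congr 1
    refine integral_congr_ae (ae_of_all _ fun x => ?_)
    by_cases hx : x ∈ tsupport φ
    · simp only [hfd, fderiv_mollify_eq_integral hU h ρ (hρ x hx)]
      ring
    · simp [image_eq_zero_of_notMem_tsupport hx]
  · simp only [hfd]
    exact Continuous.integrable_of_hasCompactSupport
      (((hb'.comp hmc).mul hmdc).mul φ.continuous) φ.hasCompactSupport.mul_left
  · exact Continuous.integrable_of_hasCompactSupport ((hbc.comp hmc).mul hφdc) hφs.mul_left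
  · exact Continuous.integrable_of_hasCompactSupport ((hbc.comp hmc).mul φ.continuous)
      φ.hasCompactSupport.mul_left
  · exact fun x _ => (hd x).differentiableAt
  · exact fun x _ => hφd.differentiable one_ne_zero x

/-- `ϑ` is a weak limit of averages of `b'` along the mollified `U`. Each average lies in `[0, 1]`,
and the ultrafilter is fixed before `φ` and `v`, so the same `ϑ` serves them all. -/
theorem exists_chain_rule {Ω : Opens E} {U : E → ℝ} (hU : Integrable U)
    {m : Measure E} [IsFiniteMeasure m]
    {T : E → E → ℝ} (hT : ∀ v, Measurable (T v)) {C : E → ℝ} (hC : ∀ v y, ‖T v y‖ ≤ C v)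
    (h : ∀ (φ : 𝓓(Ω, ℝ)) (v : E), ∫ x, U x * fderiv ℝ φ x v = -∫ y, φ y * T v y ∂m)
    {b b' : ℝ → ℝ} (hb : ∀ s, HasDerivAt b (b' s) s) (hb' : Continuous b')
    (hb'01 : ∀ s, b' s ∈ Set.Icc (0 : ℝ) 1) {K : ℝ} (hK : ∀ s, ‖b s‖ ≤ K) :
    ∃ ϑ : E → ℝ, Measurable ϑ ∧ (∀ x, ϑ x ∈ Set.Icc (0 : ℝ) 1) ∧
      ∀ (φ : 𝓓(Ω, ℝ)) (v : E),
        ∫ x, b (U x) * fderiv ℝ φ x v = -∫ y, φ y * T v y * ϑ y ∂m := by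
  -- The bounded ratio 2 of outer to inner radius is what a.e. convergence of the mollifications
  -- requires.
  let ρ : ℕ → ContDiffBump (0 : E) := fun n =>
    ⟨1 / ((n : ℝ) + 1), 2 * (1 / ((n : ℝ) + 1)), by positivity, by
      have : 0 < 1 / ((n : ℝ) + 1) := by positivity
      linarith⟩
  have hρ0 : Tendsto (fun n => (ρ n).rOut) atTop (𝓝 0) := by
    simpa [ρ] using (tendsto_one_div_add_atTop_nhds_zero_nat (𝕜 := ℝ)).const_mul 2
  have hmc : ∀ n, Continuous (mollify (ρ n) U) := fun n => (contDiff_mollify (ρ n) hU).continuous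
  have hbc : Continuous b := continuous_iff_continuousAt.2 fun s => (hb s).continuousAt
  have hconv : ∀ᵐ x, Tendsto (fun n => mollify (ρ n) U x) atTop (𝓝 (U x)) :=
    ContDiffBump.ae_convolution_tendsto_right_of_locallyIntegrable (K := 2) hρ0
      (Eventually.of_forall fun n => le_rfl) hU.locallyIntegrable
  let θ : ℕ → E → ℝ := fun n => average (ρ n) fun x => b' (mollify (ρ n) U x)
  have hwc : ∀ n, Continuous fun x => b' (mollify (ρ n) U x) := fun n => hb'.comp (hmc n)
  have hθm : ∀ n, Measurable (θ n) := fun n => measurable_average _ (hwc n)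
  have hθ01 : ∀ n x, θ n x ∈ Set.Icc (0 : ℝ) 1 := fun n x =>
    average_mem_Icc _ (hwc n) (fun _ => hb'01 _) x
  obtain ⟨ϑ, hϑm, hϑ01, hlim⟩ := exists_weak_limit_of_mem_Icc (m := m) hθm hθ01
  refine ⟨ϑ, hϑm, hϑ01, fun φ v => ?_⟩
  have hφd : ContDiff ℝ 1 φ := φ.contDiff.of_le (by simp)
  have hφdc : Continuous fun x => fderiv ℝ φ x v :=
    (hφd.continuous_fderiv one_ne_zero).clm_apply continuous_const
  have hφs : HasCompactSupport fun x => fderiv ℝ φ x v := φ.hasCompactSupport.fderiv_apply ℝ v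
  obtain ⟨M, hM⟩ := φ.continuous.bounded_above_of_compact_support φ.hasCompactSupport
  have hM0 : 0 ≤ M := (norm_nonneg _).trans (hM 0)
  have hCv : 0 ≤ C v := (norm_nonneg _).trans (hC v 0)
  have lim1 : Tendsto (fun n => ∫ x, b (mollify (ρ n) U x) * fderiv ℝ φ x v) atTop
      (𝓝 (∫ x, b (U x) * fderiv ℝ φ x v)) := by
    refine tendsto_integral_of_dominated_convergence (fun x => K * ‖fderiv ℝ φ x v‖)
      (fun n => ((hbc.comp (hmc n)).mul hφdc).aestronglyMeasurable)
      ((hφdc.integrable_of_hasCompactSupport hφs).norm.const_mul _)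
      (fun n => ae_of_all _ fun x => ?_) ?_
    · rw [norm_mul]
      exact mul_le_mul_of_nonneg_right (hK _) (norm_nonneg _)
    · filter_upwards [hconv] with x hx
      exact ((hbc.tendsto _).comp hx).mul_const _
  have hTφb : ∀ y, ‖φ y * T v y‖ ≤ M * C v := fun y => by
    rw [norm_mul]; exact mul_le_mul (hM _) (hC _ _) (norm_nonneg _) hM0
  have hTφm : Measurable fun y => φ y * T v y := φ.continuous.measurable.mul (hT v)
  have lim2 := hlim (fun y => φ y * T v y)
    (MemLp.of_bound hTφm.aestronglyMeasurable _ (ae_of_all _ hTφb))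
  -- Pulling `φ` out of the average costs only its oscillation at scale `rOut`, which vanishes
  -- uniformly.
  have lim3 : Tendsto (fun n => (∫ x, b (mollify (ρ n) U x) * fderiv ℝ φ x v) +
      ∫ y, φ y * T v y * θ n y ∂m) atTop (𝓝 0) := by
    obtain ⟨δ, hδ, hδΩ⟩ := φ.hasCompactSupport.isCompact.exists_cthickening_subset_open
      Ω.isOpen φ.tsupport_subset
    have huc : UniformContinuous φ :=
      φ.hasCompactSupport.uniformContinuous_of_continuous φ.continuous
    rw [Metric.tendsto_nhds]
    intro ε hε
    -- Chosen so that the total error is at most `ε / 2`; the `+ 1` keeps the denominator positive.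
    let η : ℝ := ε / (2 * (C v * m.real Set.univ + 1))
    have hden : 0 < C v * m.real Set.univ + 1 := by positivity
    have hη : 0 < η := by positivity
    obtain ⟨r, hr, hrφ⟩ := Metric.uniformContinuous_iff.1 huc η hη
    filter_upwards [hρ0.eventually (gt_mem_nhds hδ), hρ0.eventually (gt_mem_nhds hr)] with n h1 h2
    have hsub : ∀ x ∈ tsupport φ, Metric.closedBall x (ρ n).rOut ⊆ Ω := fun x hx =>
      ((Metric.closedBall_subset_closedBall h1.le).trans
        (Metric.closedBall_subset_cthickening hx δ)).trans hδΩ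
    rw [integral_comp_mollify_mul_fderiv hU (hT v) (hC v) (fun φ => h φ v) hb hb' φ (ρ n) hsub]
    have hAm : Measurable (average (ρ n) fun x => φ x * b' (mollify (ρ n) U x)) :=
      measurable_average _ (φ.continuous.mul (hwc n))
    have hdiff : ∀ y, |average (ρ n) (fun x => φ x * b' (mollify (ρ n) U x)) y - φ y * θ n y| ≤ η :=
      fun y => abs_average_mul_sub_le (ρ n) (hwc n) (fun _ => hb'01 _) φ.continuous hM
        fun x hx => (hrφ (hx.trans h2)).le
    have hθb : ∀ y, ‖θ n y‖ ≤ 1 := fun y => by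
      rw [Real.norm_of_nonneg (hθ01 n y).1]; exact (hθ01 n y).2
    have i2 : Integrable (fun y => φ y * T v y * θ n y) m := by
      refine Integrable.of_bound (hTφm.mul (hθm n)).aestronglyMeasurable (M * C v * 1)
        (ae_of_all _ fun y => ?_)
      rw [norm_mul]
      exact mul_le_mul (hTφb y) (hθb y) (norm_nonneg _) (by positivity)
    have hdb : ∀ y, ‖T v y * (average (ρ n) (fun x => φ x * b' (mollify (ρ n) U x)) y
        - φ y * θ n y)‖ ≤ C v * η := fun y => by
      rw [norm_mul]; exact mul_le_mul (hC _ _) (hdiff y) (abs_nonneg _) hCv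
    have i3 : Integrable (fun y => T v y * (average (ρ n) (fun x => φ x * b' (mollify (ρ n) U x)) y
        - φ y * θ n y)) m :=
      Integrable.of_bound ((hT v).mul (hAm.sub (φ.continuous.measurable.mul
        (hθm n)))).aestronglyMeasurable _ (ae_of_all _ hdb)
    have e : ∫ y, T v y * average (ρ n) (fun x => φ x * b' (mollify (ρ n) U x)) y ∂m =
        (∫ y, φ y * T v y * θ n y ∂m) + ∫ y, T v y *
          (average (ρ n) (fun x => φ x * b' (mollify (ρ n) U x)) y - φ y * θ n y) ∂m := by
      rw [← integral_add i2 i3]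
      exact integral_congr_ae (ae_of_all _ fun y => by ring)
    rw [e, dist_zero_right, neg_add_rev, neg_add_cancel_right, norm_neg]
    calc _ ≤ C v * η * m.real Set.univ := norm_integral_le_of_norm_le_const (ae_of_all _ hdb)
      _ = η * (C v * m.real Set.univ) := by ring
      _ ≤ η * (C v * m.real Set.univ + 1) := by gcongr; linarith
      _ = ε / 2 := by simp only [η]; field_simp
      _ < ε := half_lt_self hε
  have hyp : (hyperfilter ℕ : Filter ℕ) ≤ atTop := Nat.hyperfilter_le_atTop
  have := tendsto_nhds_unique ((lim1.mono_left hyp).add lim2) (lim3.mono_left hyp)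
  linarith

end Mollification

/-! ### Weak gradients on `Ω` and composition -/

section WeakGradient

variable {d : ℕ} {Ω : Opens (EuclideanSpace ℝ (Fin d))}

theorem measurableEmbedding_coe (Ω : Opens (EuclideanSpace ℝ (Fin d))) :
    MeasurableEmbedding (Subtype.val : Ω → EuclideanSpace ℝ (Fin d)) :=
  MeasurableEmbedding.subtype_coe Ω.isOpen.measurableSet

theorem map_leb (Ω : Opens (EuclideanSpace ℝ (Fin d))) :
    (leb Ω).map Subtype.val = volume.restrict (Ω : Set (EuclideanSpace ℝ (Fin d))) := by
  rw [leb, (measurableEmbedding_coe Ω).map_comap, Subtype.range_coe]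

theorem integral_leb {G : Type*} [NormedAddCommGroup G] [NormedSpace ℝ G]
    {F : EuclideanSpace ℝ (Fin d) → G} (hF : ∀ x ∉ Ω, F x = 0) :
    ∫ x : Ω, F x ∂(leb Ω) = ∫ x, F x := by
  rw [← (measurableEmbedding_coe Ω).integral_map, map_leb]
  exact setIntegral_eq_integral_of_forall_compl_eq_zero hF

theorem isFiniteMeasure_leb (hΩ : Bornology.IsBounded (Ω : Set (EuclideanSpace ℝ (Fin d)))) :
    IsFiniteMeasure (leb Ω) := by
  refine ⟨?_⟩
  have h := map_leb Ω
  have : (leb Ω) Set.univ = ((leb Ω).map Subtype.val) Set.univ := by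
    rw [(measurableEmbedding_coe Ω).map_apply, Set.preimage_univ]
  rw [this, h, Measure.restrict_apply_univ]
  exact hΩ.measure_lt_top

theorem contDiff_one (φ : 𝓓(Ω, ℝ)) : ContDiff ℝ 1 φ := φ.contDiff.of_le (by simp)

theorem exists_norm_le (φ : 𝓓(Ω, ℝ)) : ∃ C, ∀ x, ‖φ x‖ ≤ C :=
  φ.continuous.bounded_above_of_compact_support φ.hasCompactSupport

theorem continuous_gradient (φ : 𝓓(Ω, ℝ)) : Continuous (∇ (φ : EuclideanSpace ℝ (Fin d) → ℝ)) :=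
  (InnerProductSpace.toDual ℝ (EuclideanSpace ℝ (Fin d))).symm.continuous.comp
    ((contDiff_one φ).continuous_fderiv one_ne_zero)

theorem exists_norm_gradient_le (φ : 𝓓(Ω, ℝ)) :
    ∃ C, ∀ x, ‖∇ (φ : EuclideanSpace ℝ (Fin d) → ℝ) x‖ ≤ C := by
  obtain ⟨C, hC⟩ := ((contDiff_one φ).continuous_fderiv one_ne_zero).bounded_above_of_compact_support
    (φ.hasCompactSupport.fderiv ℝ)
  refine ⟨C, fun x => ?_⟩
  rw [gradient, LinearIsometryEquiv.norm_map]
  exact hC x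

theorem integrable_smul_gradient {u : Ω → ℝ} (hu : Integrable u (leb Ω)) (φ : 𝓓(Ω, ℝ)) :
    Integrable (fun x : Ω => u x • ∇ φ (x : EuclideanSpace ℝ (Fin d))) (leb Ω) := by
  obtain ⟨C, hC⟩ := exists_norm_gradient_le φ
  exact hu.smul_bdd C ((continuous_gradient φ).comp continuous_subtype_val).aestronglyMeasurable
    (ae_of_all _ fun x => hC x)

theorem integrable_test_smul {m : Measure Ω} {σ : Ω → EuclideanSpace ℝ (Fin d)}
    (hσ : Integrable σ m) (φ : 𝓓(Ω, ℝ)) :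
    Integrable (fun x : Ω => φ (x : EuclideanSpace ℝ (Fin d)) • σ x) m := by
  obtain ⟨C, hC⟩ := exists_norm_le φ
  exact hσ.bdd_smul C (φ.continuous.comp continuous_subtype_val).aestronglyMeasurable
    (ae_of_all _ fun x => hC x)

theorem hasWeakGradient_withDensityᵥ_iff {u : Ω → ℝ} {m : Measure Ω} [IsFiniteMeasure m]
    {σ : Ω → EuclideanSpace ℝ (Fin d)} (hσ : Integrable σ m) :
    HasWeakGradient u (m.withDensityᵥ σ) ↔ ∀ φ : 𝓓(Ω, ℝ),
      ∫ x : Ω, u x • ∇ φ (x : EuclideanSpace ℝ (Fin d)) ∂(leb Ω) =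
        -∫ x : Ω, φ (x : EuclideanSpace ℝ (Fin d)) • σ x ∂m := by
  refine forall_congr' fun φ => ?_
  obtain ⟨C, hC⟩ := exists_norm_le φ
  rw [integral_withDensityᵥ_lsmul (φ := fun x : Ω => φ x) hσ
    (φ.continuous.comp continuous_subtype_val).measurable fun x => hC x]

theorem integral_smul_gradient_eq_iff {u : Ω → ℝ} {U : EuclideanSpace ℝ (Fin d) → ℝ}
    (hUu : ∀ x : Ω, U x = u x) (hu : Integrable u (leb Ω)) {m : Measure Ω}
    {σ : Ω → EuclideanSpace ℝ (Fin d)} (hσ : Integrable σ m) (φ : 𝓓(Ω, ℝ)) :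
    ∫ x : Ω, u x • ∇ φ (x : EuclideanSpace ℝ (Fin d)) ∂(leb Ω) =
        -∫ x : Ω, φ (x : EuclideanSpace ℝ (Fin d)) • σ x ∂m ↔
      ∀ v, ∫ x, U x * fderiv ℝ φ x v =
        -∫ x : Ω, φ (x : EuclideanSpace ℝ (Fin d)) * inner ℝ v (σ x) ∂m := by
  have h1 : ∀ v, inner ℝ v (∫ x : Ω, u x • ∇ φ (x : EuclideanSpace ℝ (Fin d)) ∂(leb Ω)) =
      ∫ x, U x * fderiv ℝ φ x v := by
    intro v
    rw [← integral_inner (integrable_smul_gradient hu φ), ← integral_leb (Ω := Ω)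
      (fun x hx => by simp [fderiv_of_notMem_tsupport ℝ fun h => hx (φ.tsupport_subset h)])]
    refine integral_congr_ae (ae_of_all _ fun x => ?_)
    simp [real_inner_smul_right, inner_gradient_right, hUu]
  have h2 : ∀ v, inner ℝ v (-∫ x : Ω, φ (x : EuclideanSpace ℝ (Fin d)) • σ x ∂m) =
      -∫ x : Ω, φ (x : EuclideanSpace ℝ (Fin d)) * inner ℝ v (σ x) ∂m := by
    intro v
    rw [inner_neg_right, ← integral_inner (integrable_test_smul hσ φ)]
    simp [real_inner_smul_right]
  constructor
  · intro h v
    rw [← h1, ← h2, h]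
  · intro h
    refine ext_inner_left ℝ fun v => ?_
    rw [h1, h2, h]

theorem HasWeakGradient.exists_comp {u : Ω → ℝ} (hu : Integrable u (leb Ω)) {m : Measure Ω}
    [IsFiniteMeasure m] {σ : Ω → EuclideanSpace ℝ (Fin d)} (hσm : Measurable σ)
    (hσ1 : ∀ x, ‖σ x‖ ≤ 1) (h : HasWeakGradient u (m.withDensityᵥ σ))
    {b b' : ℝ → ℝ} (hb : ∀ s, HasDerivAt b (b' s) s) (hb' : Continuous b')
    (hb'01 : ∀ s, b' s ∈ Set.Icc (0 : ℝ) 1) {K : ℝ} (hK : ∀ s, ‖b s‖ ≤ K)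
    (hbu : Integrable (fun x => b (u x)) (leb Ω)) :
    ∃ ϑ : Ω → ℝ, Measurable ϑ ∧ (∀ x, ϑ x ∈ Set.Icc (0 : ℝ) 1) ∧
      HasWeakGradient (fun x => b (u x)) (m.withDensityᵥ fun x => ϑ x • σ x) := by
  have he := measurableEmbedding_coe Ω
  have hσ : Integrable σ m := Integrable.of_bound hσm.aestronglyMeasurable 1 (ae_of_all _ hσ1)
  -- Mollification needs a function on the whole space. The values off `Ω`, where `b (U x)` is `b
  -- 0`, are harmless since test functions vanish there.
  let U : EuclideanSpace ℝ (Fin d) → ℝ := Function.extend Subtype.val u fun _ => 0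
  let S : EuclideanSpace ℝ (Fin d) → EuclideanSpace ℝ (Fin d) := Function.extend Subtype.val σ fun _ => 0
  have hUu : ∀ x : Ω, U x = u x := Subtype.val_injective.extend_apply u _
  have hSσ : ∀ x : Ω, S x = σ x := Subtype.val_injective.extend_apply σ _
  have hno : ∀ x ∉ Ω, ¬∃ a : Ω, (a : EuclideanSpace ℝ (Fin d)) = x := by
    rintro x hx ⟨a, rfl⟩; exact hx a.2
  have hU0 : ∀ x ∉ Ω, U x = 0 := fun x hx => Function.extend_apply' u _ x (hno x hx)
  have hS0 : ∀ x ∉ Ω, S x = 0 := fun x hx => Function.extend_apply' σ _ x (hno x hx)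
  have hUi : Integrable U := by
    have h1 : IntegrableOn U (Ω : Set (EuclideanSpace ℝ (Fin d))) := by
      rw [IntegrableOn, ← map_leb, he.integrable_map_iff]
      exact hu.congr (ae_of_all _ fun x => (hUu x).symm)
    exact h1.integrable_of_forall_notMem_eq_zero hU0
  have hSm : Measurable S := he.measurable_extend hσm measurable_const
  have hS1 : ∀ x, ‖S x‖ ≤ 1 := by
    intro x
    by_cases hx : x ∈ Ω
    · rw [hSσ ⟨x, hx⟩]; exact hσ1 _
    · rw [hS0 x hx, norm_zero]; exact zero_le_one
  have hmap : ∀ F : EuclideanSpace ℝ (Fin d) → ℝ, ∫ y, F y ∂(m.map Subtype.val) =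
      ∫ y : Ω, F y ∂m := fun F => he.integral_map F
  rw [hasWeakGradient_withDensityᵥ_iff hσ] at h
  obtain ⟨ϑ, hϑm, hϑ01, hϑ⟩ := exists_chain_rule (Ω := Ω) hUi (m := m.map Subtype.val)
    (T := fun v y => inner ℝ v (S y)) (C := fun v => ‖v‖) (fun v => measurable_const.inner hSm)
    (fun v y => (norm_inner_le_norm v (S y)).trans
      (mul_le_of_le_one_right (norm_nonneg v) (hS1 y)))
    (fun φ v => by
      rw [hmap, (integral_smul_gradient_eq_iff hUu hu hσ φ).1 (h φ) v]
      simp only [hSσ]) hb hb' hb'01 hK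
  have hϑb : ∀ x, ‖ϑ x‖ ≤ 1 := fun x => by
    rw [Real.norm_of_nonneg (hϑ01 x).1]; exact (hϑ01 x).2
  have hϑσ : Integrable (fun x : Ω => ϑ x • σ x) m :=
    hσ.bdd_smul 1 (hϑm.comp measurable_subtype_coe).aestronglyMeasurable
      (ae_of_all _ fun x => hϑb x)
  refine ⟨fun x => ϑ x, hϑm.comp measurable_subtype_coe, fun x => hϑ01 x, ?_⟩
  rw [hasWeakGradient_withDensityᵥ_iff hϑσ]
  intro φ
  rw [integral_smul_gradient_eq_iff (U := fun x => b (U x)) (fun x => by rw [hUu])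
    hbu hϑσ φ]
  intro v
  rw [hϑ, hmap]
  congr 1
  refine integral_congr_ae (ae_of_all _ fun x => ?_)
  simp only [hSσ, real_inner_smul_right]
  ring

end WeakGradient

/-! ### The smooth cutoff -/

section Cutoff

theorem hasDerivAt_max_zero_sq (x : ℝ) :
    HasDerivAt (fun s : ℝ => max s 0 ^ 2) (2 * max x 0) x := by
  rcases lt_trichotomy x 0 with hx | rfl | hx
  · rw [max_eq_right hx.le, mul_zero]
    refine (hasDerivAt_const x (0 : ℝ)).congr_of_eventuallyEq ?_
    filter_upwards [eventually_lt_nhds hx] with s hs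
    simp [max_eq_right hs.le]
  · rw [hasDerivAt_iff_isLittleO_nhds_zero]
    refine (Asymptotics.IsBigO.of_bound 1 (Eventually.of_forall fun s => ?_)).trans_isLittleO
      ((Asymptotics.isLittleO_pow_id (n := 2) one_lt_two))
    simp only [zero_add, max_self, mul_zero, smul_eq_mul, sub_zero, norm_pow, one_mul, ne_eq,
      OfNat.ofNat_ne_zero, not_false_eq_true, zero_pow]
    gcongr
    rcases le_total s 0 with h | h <;> simp [h]
  · rw [max_eq_left hx.le]
    refine (by simpa using hasDerivAt_pow 2 x : HasDerivAt (fun s : ℝ => s ^ 2) (2 * x) x).congr_of_eventuallyEq ?_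
    filter_upwards [eventually_gt_nhds hx] with s hs
    simp [max_eq_left hs.le]

/-- A bounded nondecreasing function, zero on `(-∞, c]` and strictly between `0` and `s - c` for
`s > c`, of class `C¹` with derivative in `[0, 1]`. -/
noncomputable def bend (c s : ℝ) : ℝ := max (s - c) 0 ^ 2 / (1 + max (s - c) 0 ^ 2)

/-- The derivative of `bend c`. -/
noncomputable def bendDeriv (c s : ℝ) : ℝ := 2 * max (s - c) 0 / (1 + max (s - c) 0 ^ 2) ^ 2

theorem hasDerivAt_bend (c s : ℝ) : HasDerivAt (bend c) (bendDeriv c s) s := by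
  have h : HasDerivAt (fun s : ℝ => max (s - c) 0 ^ 2) (2 * max (s - c) 0) s :=
    (hasDerivAt_max_zero_sq (s - c)).comp_sub_const s c
  have h0 : 1 + max (s - c) 0 ^ 2 ≠ 0 := by positivity
  refine (h.div (h.const_add 1) h0).congr_deriv ?_
  unfold bendDeriv
  congr 1
  ring

theorem continuous_bendDeriv (c : ℝ) : Continuous (bendDeriv c) := by
  unfold bendDeriv
  refine Continuous.div (by fun_prop) (by fun_prop) fun s => by positivity

theorem bendDeriv_mem_Icc (c s : ℝ) : bendDeriv c s ∈ Set.Icc (0 : ℝ) 1 := by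
  have hp : 0 ≤ max (s - c) 0 := le_max_right _ _
  unfold bendDeriv
  generalize max (s - c) 0 = p at hp
  refine ⟨by positivity, ?_⟩
  rw [div_le_one (by positivity)]
  nlinarith [sq_nonneg (p - 1), sq_nonneg (p ^ 2), sq_nonneg p]

theorem norm_bend_le_one (c s : ℝ) : ‖bend c s‖ ≤ 1 := by
  have hp : 0 ≤ max (s - c) 0 := le_max_right _ _
  unfold bend
  generalize max (s - c) 0 = p at hp
  rw [Real.norm_of_nonneg (by positivity), div_le_one (by positivity)]
  linarith

theorem continuous_bend (c : ℝ) : Continuous (bend c) :=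
  continuous_iff_continuousAt.2 fun s => (hasDerivAt_bend c s).continuousAt

theorem bend_of_le {c s : ℝ} (h : s ≤ c) : bend c s = 0 := by
  simp [bend, max_eq_right (sub_nonpos.2 h)]

theorem bend_pos {c s : ℝ} (h : c < s) : 0 < bend c s := by
  have hp : 0 < max (s - c) 0 := lt_max_of_lt_left (sub_pos.2 h)
  unfold bend
  positivity

theorem bend_le_sub {c s : ℝ} (h : c < s) : bend c s ≤ s - c := by
  have hp : 0 < s - c := sub_pos.2 h
  unfold bend
  rw [max_eq_left hp.le, div_le_iff₀ (by positivity)]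
  nlinarith [sq_nonneg (s - c - 1)]

/-- For `s > c`, bending lowers `s` by at most `s - c`, so the result stays above `c ≥ t`. -/
theorem abs_sub_bend_sub_le {c s t : ℝ} (ht : t ≤ c) : |s - bend c s - t| ≤ |s - t| := by
  rcases le_or_gt s c with h | h
  · rw [bend_of_le h, sub_zero]
  · have h1 := bend_pos h
    have h2 := bend_le_sub h
    rw [abs_of_nonneg (by linarith), abs_of_nonneg (by linarith)]
    linarith

theorem le_of_abs_sub_bend_sub_eq {c s t : ℝ} (ht : t ≤ c) (h : |s - bend c s - t| = |s - t|) :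
    s ≤ c := by
  by_contra! hs
  have h1 := bend_pos hs
  have h2 := bend_le_sub hs
  rw [abs_of_nonneg (by linarith), abs_of_nonneg (by linarith)] at h
  linarith

end Cutoff

/-! ### The total variation does not increase -/

section Energy

theorem variation_withDensityᵥ_smul_le {X E : Type*} [MeasurableSpace X] [NormedAddCommGroup E]
    [NormedSpace ℝ E] [CompleteSpace E] {m : Measure X} {σ : X → E} (hσ : Integrable σ m)
    {η : X → ℝ} (hη : Measurable η) (hη1 : ∀ x, ‖η x‖ ≤ 1) :
    (m.withDensityᵥ fun x => η x • σ x).variation ≤ (m.withDensityᵥ σ).variation := by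
  have h : Integrable (fun x => η x • σ x) m :=
    hσ.bdd_smul 1 hη.aestronglyMeasurable (ae_of_all _ hη1)
  rw [Measure.variation_withDensityᵥ hσ, Measure.variation_withDensityᵥ h]
  refine withDensity_mono (ae_of_all _ fun x => ?_)
  simp only [← ofReal_norm, norm_smul]
  exact ENNReal.ofReal_le_ofReal (mul_le_of_le_one_left (norm_nonneg _) (hη1 x))

variable {d : ℕ} {Ω : Opens (EuclideanSpace ℝ (Fin d))}

theorem integrable_bend_comp (hΩ : Bornology.IsBounded (Ω : Set (EuclideanSpace ℝ (Fin d))))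
    {u : Ω → ℝ} (hu : Integrable u (leb Ω)) (c : ℝ) : Integrable (fun x => bend c (u x)) (leb Ω) := by
  have := isFiniteMeasure_leb hΩ
  exact Integrable.of_bound ((continuous_bend c).comp_aestronglyMeasurable hu.aestronglyMeasurable) 1
    (ae_of_all _ fun x => norm_bend_le_one c _)

theorem HasWeakGradient.exists_sub_bend
    (hΩ : Bornology.IsBounded (Ω : Set (EuclideanSpace ℝ (Fin d))))
    {u : Ω → ℝ} (hu : Integrable u (leb Ω)) {m : Measure Ω}
    [IsFiniteMeasure m] {σ : Ω → EuclideanSpace ℝ (Fin d)} (hσm : Measurable σ)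
    (hσ1 : ∀ x, ‖σ x‖ ≤ 1) (h : HasWeakGradient u (m.withDensityᵥ σ)) (c : ℝ) :
    ∃ η : Ω → ℝ, Measurable η ∧ (∀ x, ‖η x‖ ≤ 1) ∧
      HasWeakGradient (fun x => u x - bend c (u x)) (m.withDensityᵥ fun x => η x • σ x) := by
  have hb := integrable_bend_comp hΩ hu c
  obtain ⟨ϑ, hϑm, hϑ01, hϑ⟩ := h.exists_comp hu hσm hσ1 (hasDerivAt_bend c)
    (continuous_bendDeriv c) (bendDeriv_mem_Icc c) (norm_bend_le_one c) hb
  have hσ : Integrable σ m := Integrable.of_bound hσm.aestronglyMeasurable 1 (ae_of_all _ hσ1)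
  have hη1 : ∀ x, ‖1 - ϑ x‖ ≤ 1 := fun x => by
    rw [Real.norm_eq_abs, abs_le]
    constructor <;> linarith [(hϑ01 x).1, (hϑ01 x).2]
  have hϑ1 : ∀ x, ‖ϑ x‖ ≤ 1 := fun x => by
    rw [Real.norm_of_nonneg (hϑ01 x).1]; exact (hϑ01 x).2
  have hηm : Measurable fun x => 1 - ϑ x := measurable_const.sub hϑm
  refine ⟨fun x => 1 - ϑ x, hηm, hη1, ?_⟩
  have hϑi : Integrable (fun x => ϑ x • σ x) m :=
    hσ.bdd_smul 1 hϑm.aestronglyMeasurable (ae_of_all _ hϑ1)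
  have hηi : Integrable (fun x => (1 - ϑ x) • σ x) m :=
    hσ.bdd_smul 1 hηm.aestronglyMeasurable (ae_of_all _ hη1)
  rw [hasWeakGradient_withDensityᵥ_iff hηi]
  rw [hasWeakGradient_withDensityᵥ_iff hσ] at h
  rw [hasWeakGradient_withDensityᵥ_iff hϑi] at hϑ
  intro φ
  simp only [sub_smul, one_smul, smul_sub]
  rw [integral_sub (integrable_smul_gradient hu φ) (integrable_smul_gradient hb φ),
    integral_sub (integrable_test_smul hσ φ) (integrable_test_smul hϑi φ), h φ, hϑ φ]
  abel

theorem TVpwL_sub_bend_le (hΩ : Bornology.IsBounded (Ω : Set (EuclideanSpace ℝ (Fin d))))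
    {γ : Measure Ω} [IsFiniteMeasure γ] {u : Ω → ℝ} (hu : Integrable u (leb Ω)) (c : ℝ) :
    TVpwL γ (fun x => u x - bend c (u x)) ≤ TVpwL γ u := by
  refine le_iInf₂ fun Du hDu => le_iInf₂ fun g hg => ?_
  -- Once this norm is finite, `|Du| ≤ |Du - g| + |g|` is a finite measure, as the density
  -- representation requires.
  by_cases htop : radonNorm (Du - g) = ⊤
  · rw [htop]; exact le_top
  have hgf : IsFiniteMeasure g.variation := isFiniteMeasure_of_le γ hg
  have hsf : IsFiniteMeasure (Du - g).variation := ⟨lt_top_iff_ne_top.2 htop⟩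
  have hDf : IsFiniteMeasure Du.variation := by
    refine isFiniteMeasure_of_le ((Du - g).variation + g.variation) ?_
    simpa using VectorMeasure.variation_add_le (μ := Du - g) (ν := g)
  obtain ⟨σ, hσm, hσ, hDσ, hσ1⟩ := exists_withDensityᵥ_eq Du (Du.variation + g.variation)
    (Measure.le_add_right le_rfl)
  obtain ⟨τ, hτm, hτ, hgτ, hτ1⟩ := exists_withDensityᵥ_eq g (Du.variation + g.variation)
    (Measure.le_add_left le_rfl)
  have hm : IsFiniteMeasure (Du.variation + g.variation) := inferInstance
  generalize Du.variation + g.variation = m at *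
  subst hDσ hgτ
  obtain ⟨η, hηm, hη1, hη⟩ := hDu.exists_sub_bend hΩ hu hσm hσ1 c
  have hησ : Integrable (fun x => η x • σ x) m :=
    hσ.bdd_smul 1 hηm.aestronglyMeasurable (ae_of_all _ hη1)
  have hητ : Integrable (fun x => η x • τ x) m :=
    hτ.bdd_smul 1 hηm.aestronglyMeasurable (ae_of_all _ hη1)
  -- The competitor for `g` is `g` scaled by the same factor `η` as the gradient.
  refine (iInf₂_le _ hη).trans ((iInf₂_le (m.withDensityᵥ fun x => η x • τ x)
    ((variation_withDensityᵥ_smul_le hτ hηm hη1).trans hg)).trans ?_)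
  rw [radonNorm, radonNorm, ← withDensityᵥ_sub hησ hητ, ← withDensityᵥ_sub hσ hτ]
  have := variation_withDensityᵥ_smul_le (hσ.sub hτ) hηm hη1 Set.univ
  have e : ((fun x => η x • σ x) - fun x => η x • τ x) = fun x => η x • (σ - τ) x := by
    ext1 x
    simp [smul_sub]
  rwa [e]

end Energy

/-! ### Comparison with the minimiser -/

section Minimizer

variable {d : ℕ} {Ω : Opens (EuclideanSpace ℝ (Fin d))}

theorem hasWeakGradient_zero : HasWeakGradient (0 : Ω → ℝ) 0 := fun φ => by simp

theorem zero_mem_BV : (0 : Ω → ℝ) ∈ BV Ω := ⟨integrable_zero _ _ _, 0, hasWeakGradient_zero⟩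

theorem TVpwL_zero (γ : Measure Ω) : TVpwL γ (0 : Ω → ℝ) = 0 := by
  refine le_antisymm ?_ bot_le
  refine (iInf₂_le 0 hasWeakGradient_zero).trans ((iInf₂_le 0 ?_).trans ?_)
  · rw [VectorMeasure.variation_zero]; exact Measure.zero_le _
  · simp [radonNorm]

theorem HasWeakGradient.neg {u : Ω → ℝ} {μ : VectorMeasure Ω (EuclideanSpace ℝ (Fin d))}
    (h : HasWeakGradient u μ) : HasWeakGradient (-u) (-μ) := fun φ => by
  rw [VectorMeasure.integral_neg_vectorMeasure, ← h φ, ← integral_neg]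
  simp

theorem neg_mem_BV {u : Ω → ℝ} (h : u ∈ BV Ω) : -u ∈ BV Ω :=
  ⟨h.1.neg, h.2.imp' (fun μ => -μ) fun _ hμ => hμ.neg⟩

theorem TVpwL_neg_le (γ : Measure Ω) (u : Ω → ℝ) : TVpwL γ (-u) ≤ TVpwL γ u := by
  refine le_iInf₂ fun Du hDu => le_iInf₂ fun g hg => ?_
  refine (iInf₂_le _ hDu.neg).trans ((iInf₂_le (-g) ?_).trans ?_)
  · rwa [VectorMeasure.variation_neg]
  · rw [radonNorm, radonNorm, ← neg_sub', VectorMeasure.variation_neg]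

theorem TVpwL_neg (γ : Measure Ω) (u : Ω → ℝ) : TVpwL γ (-u) = TVpwL γ u :=
  le_antisymm (TVpwL_neg_le γ u) (by simpa using TVpwL_neg_le γ (-u))

theorem energy_neg_neg (γ : Measure Ω) (f u : Ω → ℝ) : energy γ (-f) (-u) = energy γ f u := by
  rw [energy, energy, TVpwL_neg, ← eLpNorm_neg, neg_sub_neg, neg_sub]

theorem isMinOn_energy_neg {γ : Measure Ω} {f u : Ω → ℝ} (h : IsMinOn (energy γ f) (BV Ω) u) :
    IsMinOn (energy γ (-f)) (BV Ω) (-u) := fun v hv => by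
  have := h (neg_mem_BV hv)
  rw [Set.mem_ofPred_eq] at this ⊢
  rwa [energy_neg_neg, ← neg_neg v, energy_neg_neg]

theorem energy_ne_top_of_isMinOn {γ : Measure Ω} {f u : Ω → ℝ} (hf : MemLp f 2 (leb Ω))
    (h : IsMinOn (energy γ f) (BV Ω) u) : energy γ f u ≠ ⊤ := by
  refine ne_top_of_le_ne_top ?_ (h zero_mem_BV)
  rw [energy, TVpwL_zero, add_zero, zero_sub, eLpNorm_neg]
  exact ENNReal.mul_ne_top (by simp) (ENNReal.pow_ne_top hf.2.ne)

/-- Without a weak gradient the infimum defining `TVpwL` would be empty, hence `⊤`, contradicting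
the bound by `TVpwL γ u`. -/
theorem sub_bend_mem_BV (hΩ : Bornology.IsBounded (Ω : Set (EuclideanSpace ℝ (Fin d))))
    {γ : Measure Ω} [IsFiniteMeasure γ] {u : Ω → ℝ} (hu : Integrable u (leb Ω))
    (hTV : TVpwL γ u ≠ ⊤) (c : ℝ) : (fun x => u x - bend c (u x)) ∈ BV Ω := by
  refine ⟨hu.sub (integrable_bend_comp hΩ hu c), ?_⟩
  by_contra! h
  refine hTV (top_le_iff.1 (le_trans (top_le_iff.2 ?_) (TVpwL_sub_bend_le hΩ hu c)))
  simp [TVpwL, h]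

theorem ae_le_of_isMinOn_energy (hΩ : Bornology.IsBounded (Ω : Set (EuclideanSpace ℝ (Fin d))))
    {γ : Measure Ω} [IsFiniteMeasure γ] {f u : Ω → ℝ} (hf : MemLp f 2 (leb Ω)) (hu : u ∈ BV Ω)
    (hmin : IsMinOn (energy γ f) (BV Ω) u) {c : ℝ} (hfc : ∀ᵐ x ∂(leb Ω), f x ≤ c) :
    ∀ᵐ x ∂(leb Ω), u x ≤ c := by
  have hE := energy_ne_top_of_isMinOn hf hmin
  rw [energy, ENNReal.add_ne_top] at hE
  let v : Ω → ℝ := fun x => u x - bend c (u x)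
  have hv : v ∈ BV Ω := sub_bend_mem_BV hΩ hu.1 hE.2 c
  have h1 : (1 / 2) * eLpNorm (u - f) 2 (leb Ω) ^ 2 + TVpwL γ u ≤
      (1 / 2) * eLpNorm (v - f) 2 (leb Ω) ^ 2 + TVpwL γ u :=
    (hmin hv).trans (add_le_add_right (TVpwL_sub_bend_le hΩ hu.1 c) _)
  have h2 : eLpNorm (u - f) 2 (leb Ω) ^ 2 ≤ eLpNorm (v - f) 2 (leb Ω) ^ 2 :=
    (ENNReal.mul_le_mul_iff_right (by simp) (by simp)).1 ((ENNReal.add_le_add_iff_right hE.2).1 h1)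
  have hnorm : ∀ w : Ω → ℝ, eLpNorm w 2 (leb Ω) ^ 2 = ∫⁻ x, ‖w x‖ₑ ^ 2 ∂(leb Ω) := fun w => by
    simpa using eLpNorm_nnreal_pow_eq_lintegral (f := w) (p := 2) (μ := leb Ω) two_ne_zero
  have hle : ∀ᵐ x ∂(leb Ω), ‖(v - f) x‖ₑ ^ 2 ≤ ‖(u - f) x‖ₑ ^ 2 := by
    filter_upwards [hfc] with x hx
    gcongr
    rw [← ofReal_norm, ← ofReal_norm]
    exact ENNReal.ofReal_le_ofReal (abs_sub_bend_sub_le hx)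
  have hufin : eLpNorm (u - f) 2 (leb Ω) ^ 2 ≠ ⊤ := fun h => by
    rw [h, ENNReal.mul_top (by simp)] at hE
    exact hE.1 rfl
  rw [hnorm] at hufin
  rw [hnorm, hnorm] at h2
  have hfin := ne_top_of_le_ne_top hufin (lintegral_mono_ae hle)
  have hm : AEMeasurable (fun x => ‖(u - f) x‖ₑ ^ 2) (leb Ω) :=
    (hu.1.aestronglyMeasurable.sub hf.aestronglyMeasurable).enorm.pow_const _
  -- Minimality reverses the pointwise inequality at the level of integrals; since these are finite,
  -- equality holds a.e.
  have heq := ae_eq_of_ae_le_of_lintegral_le hle hfin hm h2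
  filter_upwards [heq, hfc] with x hx hxc
  refine le_of_abs_sub_bend_sub_eq hxc ?_
  have h3 : ‖(v - f) x‖ₑ = ‖(u - f) x‖ₑ := (ENNReal.pow_right_strictMono two_ne_zero).injective hx
  have h4 := congrArg ENNReal.toReal h3
  rwa [toReal_enorm, toReal_enorm] at h4

end Minimizer

/-! ### Extended-real bounds and conclusion -/

theorem essSup_coe_le_of_forall_real {X : Type*} [MeasurableSpace X] {m : Measure X} {f u : X → ℝ}
    (h : ∀ c : ℝ, (∀ᵐ x ∂m, f x ≤ c) → ∀ᵐ x ∂m, u x ≤ c) :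
    essSup (fun x => (u x : EReal)) m ≤ essSup (fun x => (f x : EReal)) m := by
  have hf := ae_le_essSup (μ := m) (f := fun x => (f x : EReal))
  generalize essSup (fun x => (f x : EReal)) m = S at *
  refine essSup_le_of_ae_le _ ?_
  induction S with
  -- A real-valued `f` is a.e. below `⊥` only for the zero measure, where nothing is left to prove.
  | bot =>
    filter_upwards [hf] with x hx
    simp at hx
  | top => exact ae_of_all _ fun x => le_top
  | coe c =>
    filter_upwards [h c (hf.mono fun x hx => EReal.coe_le_coe_iff.1 hx)] with x hx
    exact EReal.coe_le_coe_iff.2 hx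

theorem essInf_coe_le_of_forall_real {X : Type*} [MeasurableSpace X] {m : Measure X} {f u : X → ℝ}
    (h : ∀ c : ℝ, (∀ᵐ x ∂m, c ≤ f x) → ∀ᵐ x ∂m, c ≤ u x) :
    essInf (fun x => (f x : EReal)) m ≤ essInf (fun x => (u x : EReal)) m := by
  have hf := ae_essInf_le (μ := m) (f := fun x => (f x : EReal))
  generalize essInf (fun x => (f x : EReal)) m = S at *
  refine le_essInf_of_ae_le _ ?_
  induction S with
  | bot => exact ae_of_all _ fun x => bot_le
  | top =>
    filter_upwards [hf] with x hx
    simp at hx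
  | coe c =>
    filter_upwards [h c (hf.mono fun x hx => EReal.coe_le_coe_iff.1 hx)] with x hx
    exact EReal.coe_le_coe_iff.2 hx

end PwL

theorem mainTheorem3 {d : ℕ} (Ω : Opens (EuclideanSpace ℝ (Fin d)))
    (hΩ : Bornology.IsBounded (Ω : Set (EuclideanSpace ℝ (Fin d))))
    (γ : Measure Ω) [IsFiniteMeasure γ]
    (f : Ω → ℝ) (hf : MemLp f 2 (PwL.leb Ω))
    (u : Ω → ℝ) (hu : u ∈ PwL.BV Ω) (hmin : IsMinOn (PwL.energy γ f) (PwL.BV Ω) u) :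
    essSup (fun x => (u x : EReal)) (PwL.leb Ω) ≤ essSup (fun x => (f x : EReal)) (PwL.leb Ω) ∧
      essInf (fun x => (f x : EReal)) (PwL.leb Ω) ≤ essInf (fun x => (u x : EReal)) (PwL.leb Ω) := by
  refine ⟨PwL.essSup_coe_le_of_forall_real fun c hc =>
    PwL.ae_le_of_isMinOn_energy hΩ hf hu hmin hc, PwL.essInf_coe_le_of_forall_real fun c hc => ?_⟩
  -- The lower bound is the upper bound for `-u`, `-f` and `-c`.
  have := PwL.ae_le_of_isMinOn_energy hΩ hf.neg (PwL.neg_mem_BV hu)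
    (PwL.isMinOn_energy_neg hmin) (c := -c) (hc.mono fun x hx => neg_le_neg hx)
  exact this.mono fun x hx => neg_le_neg_iff.1 hx
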